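/- \textbf{Effective conditional universality.} Let $\mathbb{X}$ be a finite alphabet with $D\ge 2$ letters. Measures are probability measures on the space $\mathbb{X}^{\mathbb{Z}}$ of two-sided sequences with the product $\sigma$-algebra, $X_k$ are the coordinates, $P(x_1^n)=P(X_1^n=x_1^n)$, $P(a|x_1^n)=P(X_{n+1}=a|X_1^n=x_1^n)$, $\log$ is the binary and $\ln$ the natural logarithm. For a stationary measure $P$ let $h_P=\lim_{n\to\infty}\frac1n\int[-\log P(X_1^n)]\,dP$ be its entropy rate. For $\sigma,\tau\in\mathbb{X}^*$ let $[\sigma,\tau]=\{x: x_{-|\sigma|+1}^{|\tau|}=\sigma\tau\}$. A real function is computable if rational approximations of its values to any prescribed precision can be computed uniformly in its arguments, where an argument from $\mathbb{X}^{\mathbb{Z}}$ is given as an oracle. A measure $R$ is computable if $(\sigma,\tau)\mapsto R([\sigma,\tau])$ is computable. A sequence $s\in\mathbb{X}^{\mathbb{Z}}$ is a representation of a measure $P$ if $P=\rho(s)$ for some (total) map $\rho$ from $\mathbb{X}^{\mathbb{Z}}$ to probability measures such that $(\sigma,\tau,s)\mapsto\rho(s)([\sigma,\tau])$ is computable. A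 Martin-L\"of $(s,P)$-test is a sequence of events $U_n=\bigcup_{(\sigma,\tau)\in V_n}[\sigma,\tau]$ with $P(U_n)\le 2^{-n}$, where the sets $V_n\subset\mathbb{X}^*\times\mathbb{X}^*$ are uniformly computably enumerable with oracle $s$. A point $x$ is $1$-$P$-random (Martin-L\"of $P$-random) if for some representation $s$ of $P$ it lies outside $\bigcap_n U_n$ for every Martin-L\"of $(s,P)$-test $(U_n)$. A measure $R$ (not necessarily stationary) is $1$-universal if it is computable and for every stationary ergodic measure $P$ we have $\lim_{n\to\infty}\frac1n[-\log R(X_1^n)]=h_P$ on all $1$-$P$-random points. Let $R$ be a $1$-universal measure such that for some real sequence $\epsilon_n\to 0$, $$-\log R(x_{n+1}|x_1^n)\le\epsilon_n\sqrt{n/\ln n}\qquad\text{for all } n\ge 2 \text{ and all } x_1^{n+1}\in\mathbb{X}^{n+1}$$ (in particular, these conditional probabilities are positive). Then for every stationary ergodic probability measure $P$, on all $1$-$P$-random points we have $P(X_1^i)>0$ for all $i$ and $$\lim_{n\to\infty}\frac1n\sum_{i=0}^{n-1}\left[-\sum_{a\in\mathbb{X}}P(a|X_1^i)\log R(a|X_1^i)\right]=h_P.$$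 -/

import Mathlib

open MeasureTheory Filter Topology

noncomputable section

namespace AlgRandom

variable {D : ℕ}

/-- Two-sided infinite sequences over the alphabet `{0, …, D - 1}`, with the product σ-algebra. -/
abbrev Seq (D : ℕ) : Type := ℤ → Fin D

/-- Finite strings over the alphabet. -/
abbrev Str (D : ℕ) : Type := List (Fin D)

/-- The string `x_j x_{j+1} … x_{j+n-1}`. In particular `word x 1 n` is `x_1^n`. -/
def word (x : Seq D) (j : ℤ) (n : ℕ) : Str D :=
  (List.range n).map fun i : ℕ => x (j + (i : ℤ))

/-- The cylinder set `(X_{-|σ|+1}^{|τ|} = στ)`. -/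
def cylinder (σ τ : Str D) : Set (Seq D) :=
  {x | word x (-(σ.length : ℤ) + 1) (σ.length + τ.length) = σ ++ τ}

/-- The shift `T`. -/
def shift (x : Seq D) : Seq D := fun i => x (i + 1)

/-- A stationary ergodic probability measure. -/
def IsStationaryErgodic (P : Measure (Seq D)) : Prop :=
  IsProbabilityMeasure P ∧ Ergodic shift P

/-- `P(w) = P(X_1^n = w)`, where `n` is the length of `w`. -/
def prob (P : Measure (Seq D)) (w : Str D) : ℝ :=
  P.real {x | word x 1 w.length = w}

/-- `P(a | w) = P(X_{n+1} = a | X_1^n = w)`, where `n` is the length of `w`. -/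
def condProb (P : Measure (Seq D)) (w : Str D) (a : Fin D) : ℝ :=
  prob P (w ++ [a]) / prob P w

/-- The entropy rate `h_P = lim_n E[-log P(X_1^n)] / n`, in bits. -/
def entropyRate (P : Measure (Seq D)) : ℝ :=
  limUnder atTop fun n : ℕ => (∫ x, -Real.logb 2 (prob P (word x 1 n)) ∂P) / (n : ℝ)

/-- The rational number coded by a triple: `(a, b, c)` codes `(a - b) / (c + 1)`. -/
def ratOf (q : ℕ × ℕ × ℕ) : ℚ := ((q.1 : ℚ) - (q.2.1 : ℚ)) / ((q.2.2 : ℚ) + 1)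

/-- A real function on a countable set is computable if its values can be approximated from below
and from above uniformly effectively: the sets of pairs `(a, q)` with `q < f a` and with `f a < q`
are computably enumerable. Equivalently, some algorithm computes from `a` and `k` a rational
number within `2 ^ (-k)` of `f a`. -/
def ComputableReal {α : Type} [Primcodable α] (f : α → ℝ) : Prop :=
  REPred (fun p : α × (ℕ × ℕ × ℕ) => ((ratOf p.2 : ℚ) : ℝ) < f p.1) ∧
  REPred (fun p : α × (ℕ × ℕ × ℕ) => f p.1 < ((ratOf p.2 : ℚ) : ℝ))

/-- A probability measure is computable if the probabilities of the cylinder sets are. -/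
def ComputableMeasure (R : Measure (Seq D)) : Prop :=
  IsProbabilityMeasure R ∧
  ComputableReal (fun p : Str D × Str D => R.real (cylinder p.1 p.2))

/-- The finite part `s_{-n+1}^n` of an oracle `s`. -/
def oracleWindow (s : Seq D) (n : ℕ) : Str D := word s (-(n : ℤ) + 1) (2 * n)

/-- The predicate `A` is computably enumerable with oracle `s`: `A a` holds exactly if it is
confirmed by a finite part of `s`, according to a computably enumerable set `W` of confirmations. -/
def CEIn {α : Type} [Primcodable α] (s : Seq D) (A : α → Prop) : Prop :=
  ∃ W : Str D × α → Prop, REPred W ∧ ∀ a, A a ↔ ∃ n, W (oracleWindow s n, a)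

/-- The predicates `A s` are computably enumerable with oracle `s`, by one and the same enumeration
procedure for all oracles `s`. -/
def UniformCE {α : Type} [Primcodable α] (A : Seq D → α → Prop) : Prop :=
  ∃ W : Str D × α → Prop, REPred W ∧ ∀ s a, A s a ↔ ∃ n, W (oracleWindow s n, a)

/-- A real function `(s, a) ↦ f s a`, where `s` is an infinite sequence used as an oracle,
is computable. -/
def ComputableRealFunctional {α : Type} [Primcodable α] (f : Seq D → α → ℝ) : Prop :=
  UniformCE (fun s (p : α × (ℕ × ℕ × ℕ)) => ((ratOf p.2 : ℚ) : ℝ) < f s p.1) ∧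
  UniformCE (fun s (p : α × (ℕ × ℕ × ℕ)) => f s p.1 < ((ratOf p.2 : ℚ) : ℝ))

/-- Representation functions: total computable maps from sequences to probability measures. -/
def IsRepresentationFunction (ρ : Seq D → Measure (Seq D)) : Prop :=
  (∀ s, IsProbabilityMeasure (ρ s)) ∧
  ComputableRealFunctional (fun s (p : Str D × Str D) => (ρ s).real (cylinder p.1 p.2))

/-- The sequence `s` is a representation of the measure `P`. -/
def IsRepresentation (s : Seq D) (P : Measure (Seq D)) : Prop :=
  ∃ ρ : Seq D → Measure (Seq D), IsRepresentationFunction ρ ∧ ρ s = P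

/-- The events `U 0, U 1, …` are uniformly `s`-c.e.: they are unions of cylinder sets given by
uniformly `s`-c.e. sets `V 0, V 1, …` of pairs of strings. -/
def UniformlyCEEvents (s : Seq D) (U : ℕ → Set (Seq D)) : Prop :=
  ∃ V : ℕ → Set (Str D × Str D),
    CEIn s (fun p : ℕ × (Str D × Str D) => p.2 ∈ V p.1) ∧
    ∀ n, U n = {x | ∃ p ∈ V n, x ∈ cylinder p.1 p.2}

/-- Martin-Löf `(s, P)`-tests. -/
def IsMartinLofTest (s : Seq D) (P : Measure (Seq D)) (U : ℕ → Set (Seq D)) : Prop :=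
  UniformlyCEEvents s U ∧ ∀ n, P.real (U n) ≤ 2⁻¹ ^ n

/-- `1`-`(s, P)`-random points. -/
def IsRandomRel (s : Seq D) (P : Measure (Seq D)) (x : Seq D) : Prop :=
  ∀ U : ℕ → Set (Seq D), IsMartinLofTest s P U → x ∉ ⋂ n, U n

/-- Martin-Löf `P`-random points, also called `1`-`P`-random. -/
def IsMartinLofRandom (P : Measure (Seq D)) (x : Seq D) : Prop :=
  ∃ s, IsRepresentation s P ∧ IsRandomRel s P x

/-- `1`-universal measures: computable probability measures `R` such that, for every stationary
ergodic `P`, `-log R(X_1^n) / n` tends to `h_P` on all `1`-`P`-random points. (The limit being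
finite, it is part of the definition that `R(X_1^n)` does not vanish there.) -/
def IsOneUniversal (R : Measure (Seq D)) : Prop :=
  ComputableMeasure R ∧
  ∀ P : Measure (Seq D), IsStationaryErgodic P → ∀ x, IsMartinLofRandom P x →
    (∀ n, 0 < prob R (word x 1 n)) ∧
    Tendsto (fun n : ℕ => -Real.logb 2 (prob R (word x 1 n)) / (n : ℝ)) atTop
      (𝓝 (entropyRate P))

end AlgRandom

/-!
The difference between the code length `-log R(X_1^n)` and the sum of its conditional expectations
`-∑ₐ P(a | X_1^i) log R(a | X_1^i)` is a martingale under `P`. Its increments are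
`o(√(n / log n))`, so by the Azuma–Hoeffding inequality the probability that it exceeds `ε n` is at
most `n⁻³` for large `n`. This event is computably enumerable relative to a representation of `P`:
sums, products and logarithms of computable reals can be approximated, and multiplying by `P(X_1^i)`
avoids dividing by probabilities that may vanish. The tails of the convergent series of these
probabilities are explicit, so the effective Borel–Cantelli lemma makes the difference `o(n)` on
every random point. Universality says that `-log R(X_1^n) / n` tends to the entropy rate.
-/

namespace AlgRandom

section Computable

variable {α : Type} [Primcodable α]

theorem computable_nat_add {f g : α → ℕ} (hf : Computable f) (hg : Computable g) :
    Computable fun a => f a + g a :=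
  Primrec.nat_add.to_comp.comp hf hg

theorem computable_nat_mul {f g : α → ℕ} (hf : Computable f) (hg : Computable g) :
    Computable fun a => f a * g a :=
  Primrec.nat_mul.to_comp.comp hf hg

theorem computable_exists_lt {f : α → ℕ} {B : α × ℕ → Bool} (hf : Computable f)
    (hB : Computable B) : Computable fun a => decide (∃ i < f a, B (a, i)) := by
  refine (Computable.nat_rec (g := fun _ => false) (h := fun a q => q.2 || B (a, q.1)) hf
    (Computable.const false) ?_).of_eq fun a => ?_
  · exact Primrec.or.to_comp.comp (Computable.snd.comp Computable.snd)
      (hB.comp (Computable.fst.pair (Computable.fst.comp Computable.snd)))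
  · induction f a with
    | zero => simp
    | succ n ih => simp only [ih, Nat.exists_lt_succ_right, Bool.decide_or, Bool.decide_eq_true]

theorem computable_forall_lt {f : α → ℕ} {B : α × ℕ → Bool} (hf : Computable f)
    (hB : Computable B) : Computable fun a => decide (∀ i < f a, B (a, i)) :=
  (Primrec.not.to_comp.comp
    (computable_exists_lt hf (Primrec.not.to_comp.comp hB))).of_eq fun a => by
      simp [← decide_not]

theorem exists_computable_of_rePred {p : α → Prop} (hp : REPred p) :
    ∃ B : α × ℕ → Bool, Computable B ∧ ∀ a, p a ↔ ∃ t, B (a, t) := by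
  obtain ⟨c, hc⟩ := Nat.Partrec.Code.exists_code.1 hp
  refine ⟨fun q => (Nat.Partrec.Code.evaln q.2 c (Encodable.encode q.1)).isSome, ?_, fun a => ?_⟩
  · exact Primrec.option_isSome.to_comp.comp (Nat.Partrec.Code.primrec_evaln.to_comp.comp
      ((Computable.snd.pair (Computable.const c)).pair (Computable.encode.comp Computable.fst)))
  · have dom_eval : p a ↔ (Nat.Partrec.Code.eval c (Encodable.encode a)).Dom := by
      simp [hc, Encodable.encodek, Part.assert]
    simp only [dom_eval, Part.dom_iff_mem, Nat.Partrec.Code.evaln_complete,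
      Option.isSome_iff_exists]
    exact exists_comm

end Computable

section CEIn

variable {D : ℕ} {α β : Type} [Primcodable α] [Primcodable β] {s : Seq D}

@[simp]
theorem length_word (x : Seq D) (j : ℤ) (n : ℕ) : (word x j n).length = n := by simp [word]

@[simp]
theorem length_oracleWindow (s : Seq D) (n : ℕ) : (oracleWindow s n).length = 2 * n :=
  length_word _ _ _

/-- The central part of length `2 * m` of a string of even length at least `2 * m`. It recovers
the earlier finite parts of an oracle from the later ones. -/
def middle (σ : Str D) (m : ℕ) : Str D := (σ.drop (σ.length / 2 - m)).take (2 * m)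

theorem middle_oracleWindow (s : Seq D) {m n : ℕ} (h : m ≤ n) :
    middle (oracleWindow s n) m = oracleWindow s m := by
  refine List.ext_getElem (by simp [middle]; lia) fun i _ _ => ?_
  simp only [middle, length_oracleWindow, Nat.mul_div_cancel_left n two_pos]
  simp only [oracleWindow, word, List.getElem_take, List.getElem_drop, List.getElem_map,
    List.getElem_range]
  congr 1
  push_cast [h]
  ring

theorem computable_middle : Computable fun p : Str D × ℕ => middle p.1 p.2 :=
  (Primrec.list_take.comp (Primrec.nat_mul.comp (Primrec.const 2) Primrec.snd)
    (Primrec.list_drop.comp (Primrec.nat_sub.comp (Primrec.nat_div.comp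
      (Primrec.list_length.comp Primrec.fst) (Primrec.const 2)) Primrec.snd) Primrec.fst)).to_comp

/-- `B` confirms `A` from the finite parts of the oracle `s`, and it confirms each instance of `A`
from all sufficiently long finite parts. -/
structure Confirms (s : Seq D) (B : Str D × α → Bool) (A : α → Prop) : Prop where
  mono : ∀ a m n, m ≤ n → B (oracleWindow s m, a) → B (oracleWindow s n, a)
  iff : ∀ a, A a ↔ ∃ n, B (oracleWindow s n, a)

theorem CEIn.of_confirmation {A : α → Prop} {B : Str D × α → Bool} (hB : Computable B)
    (h : ∀ a, A a ↔ ∃ n, B (oracleWindow s n, a)) : CEIn s A :=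
  ⟨_, (ComputablePred.computable_iff.2 ⟨B, hB, rfl⟩).to_re, h⟩

-- `B (σ, a)` searches all shorter windows inside `σ` and all running times up to `|σ|`.
theorem CEIn.exists_confirms {A : α → Prop} (h : CEIn s A) :
    ∃ B : Str D × α → Bool, Computable B ∧ Confirms s B A := by
  obtain ⟨W, hW, hA⟩ := h
  obtain ⟨C, hC, hWC⟩ := exists_computable_of_rePred hW
  have hσ : Computable fun p : Str D × α => p.1.length := Computable.list_length.comp Computable.fst
  have hhalf : Computable fun p : Str D × α => p.1.length / 2 + 1 :=
    Computable.succ.comp ((Primrec.nat_div.comp Primrec.id (Primrec.const 2)).to_comp.comp hσ)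
  refine ⟨fun p => decide (∃ m < p.1.length / 2 + 1,
      (decide (∃ t < p.1.length, C ((middle p.1 m, p.2), t)) : Bool)),
    computable_exists_lt hhalf (computable_exists_lt (hσ.comp Computable.fst) (hC.comp
      (((computable_middle.comp ((Computable.fst.comp (Computable.fst.comp Computable.fst)).pair
        (Computable.snd.comp Computable.fst))).pair
          (Computable.snd.comp (Computable.fst.comp Computable.fst))).pair Computable.snd))), ?_⟩
  have hB : ∀ a n, (∃ m < 2 * n / 2 + 1, ∃ t < 2 * n, C ((middle (oracleWindow s n) m, a), t)) ↔
      ∃ m ≤ n, ∃ t < 2 * n, C ((oracleWindow s m, a), t) := fun a n => by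
    simp only [Nat.mul_div_cancel_left n two_pos, Nat.lt_succ_iff]
    exact exists_congr fun m => and_congr_right fun hm => by rw [middle_oracleWindow s hm]
  constructor
  · intro a m n hmn
    simp only [decide_eq_true_eq, length_oracleWindow, hB]
    rintro ⟨k, hk, t, ht, hC⟩
    exact ⟨k, hk.trans hmn, t, by lia, hC⟩
  · intro a
    simp only [decide_eq_true_eq, length_oracleWindow, hB, hA, hWC]
    constructor
    · rintro ⟨m, t, h⟩
      exact ⟨m + t + 1, m, by lia, t, by lia, h⟩
    · rintro ⟨-, m, -, t, -, h⟩
      exact ⟨m, t, h⟩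

theorem CEIn.of_rePred {A : α → Prop} (h : REPred A) : CEIn s A :=
  ⟨fun p => A p.2, Partrec.comp h Computable.snd, fun a => by simp⟩

theorem CEIn.of_computable {B : α → Bool} (hB : Computable B) : CEIn s fun a => B a :=
  CEIn.of_rePred (ComputablePred.computable_iff.2 ⟨B, hB, rfl⟩).to_re

theorem CEIn.of_eq {A A' : α → Prop} (h : CEIn s A) (h' : ∀ a, A a ↔ A' a) : CEIn s A' :=
  (funext fun a => propext (h' a) : A = A') ▸ h

theorem CEIn.eq {f g : α → β} (hf : Computable f) (hg : Computable g) :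
    CEIn s fun a => f a = g a := by
  classical
  exact (CEIn.of_computable (Primrec.eq.decide.to_comp.comp hf hg)).of_eq fun _ =>
    decide_eq_true_iff

theorem CEIn.comp {A : α → Prop} (h : CEIn s A) {g : β → α} (hg : Computable g) :
    CEIn s fun b => A (g b) := by
  obtain ⟨B, hB, hA⟩ := h.exists_confirms
  exact CEIn.of_confirmation (hB.comp (Computable.fst.pair (hg.comp Computable.snd)))
    fun b => hA.iff (g b)

theorem CEIn.and {A A' : α → Prop} (h : CEIn s A) (h' : CEIn s A') :
    CEIn s fun a => A a ∧ A' a := by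
  obtain ⟨B, hB, hA⟩ := h.exists_confirms
  obtain ⟨B', hB', hA'⟩ := h'.exists_confirms
  refine CEIn.of_confirmation (Primrec.and.to_comp.comp hB hB') fun a => ?_
  simp only [hA.iff, hA'.iff, Bool.and_eq_true]
  constructor
  · rintro ⟨⟨m, hm⟩, n, hn⟩
    exact ⟨max m n, hA.mono _ _ _ (le_max_left _ _) hm, hA'.mono _ _ _ (le_max_right _ _) hn⟩
  · rintro ⟨n, hn, hn'⟩
    exact ⟨⟨n, hn⟩, n, hn'⟩

theorem CEIn.exists {A : α × β → Prop} (h : CEIn s A) : CEIn s fun a => ∃ b, A (a, b) := by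
  obtain ⟨B, hB, hA⟩ := h.exists_confirms
  have hdecode : Computable fun p : (Str D × α) × ℕ =>
      ((Encodable.decode p.2 : Option β).map fun b => B (p.1.1, (p.1.2, b))).getD false :=
    Computable.option_getD (Computable.option_map (Computable.decode.comp Computable.snd)
      (hB.comp ((Computable.fst.comp (Computable.fst.comp Computable.fst)).pair
        ((Computable.snd.comp (Computable.fst.comp Computable.fst)).pair Computable.snd))))
      (Computable.const false)
  refine CEIn.of_confirmation
    (computable_exists_lt (Computable.list_length.comp Computable.fst) hdecode) fun a => ?_
  simp only [decide_eq_true_eq, length_oracleWindow, hA.iff]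
  constructor
  · rintro ⟨b, n, hn⟩
    refine ⟨n + Encodable.encode b + 1, Encodable.encode b, by lia, ?_⟩
    simpa using hA.mono _ _ _ (by lia) hn
  · rintro ⟨n, i, -, hi⟩
    rcases hd : (Encodable.decode i : Option β) with _ | b
    · simp [hd] at hi
    · exact ⟨b, n, by simpa [hd] using hi⟩

theorem CEIn.forall_lt {A : α × ℕ → Prop} (h : CEIn s A) {f : α → ℕ} (hf : Computable f) :
    CEIn s fun a => ∀ i < f a, A (a, i) := by
  obtain ⟨B, hB, hA⟩ := h.exists_confirms
  refine CEIn.of_confirmation (computable_forall_lt (hf.comp Computable.snd) (hB.comp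
    ((Computable.fst.comp Computable.fst).pair
      ((Computable.snd.comp Computable.fst).pair Computable.snd)))) fun a => ?_
  simp only [decide_eq_true_eq, hA.iff]
  constructor
  · intro h
    choose! n hn using h
    exact ⟨(Finset.range (f a)).sup n, fun i hi =>
      hA.mono _ _ _ (Finset.le_sup (f := n) (Finset.mem_range.2 hi)) (hn i hi)⟩
  · rintro ⟨n, hn⟩ i hi
    exact ⟨n, hn i hi⟩

end CEIn

section ComputableRat

variable {α β : Type} [Primcodable α] [Primcodable β]

/-- The codes of rational numbers on which `ratOf` is defined. -/
abbrev Code : Type := ℕ × ℕ × ℕ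

/-- A rational-valued function is computable if codes of its values, in the sense of `ratOf`, can
be computed. -/
def ComputableRat (f : α → ℚ) : Prop :=
  ∃ g : α → Code, Computable g ∧ ∀ a, ratOf (g a) = f a

theorem ratOf_surjective : Function.Surjective ratOf := by
  intro r
  refine ⟨(r.num.toNat, (-r.num).toNat, r.den - 1), ?_⟩
  have hnum : ((r.num.toNat : ℚ) - ((-r.num).toNat : ℚ)) = r.num := by
    exact_mod_cast Int.toNat_sub_toNat_neg r.num
  rw [ratOf, hnum, Nat.cast_pred r.pos, sub_add_cancel, Rat.num_div_den]

/-- Addition on codes of rational numbers. The last entry of a code is one less than the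
denominator. -/
def addCode (q r : Code) : Code :=
  (q.1 * (r.2.2 + 1) + r.1 * (q.2.2 + 1), q.2.1 * (r.2.2 + 1) + r.2.1 * (q.2.2 + 1),
    q.2.2 * r.2.2 + q.2.2 + r.2.2)

/-- Multiplication on codes of rational numbers. -/
def mulCode (q r : Code) : Code :=
  (q.1 * r.1 + q.2.1 * r.2.1, q.1 * r.2.1 + q.2.1 * r.1, q.2.2 * r.2.2 + q.2.2 + r.2.2)

theorem ratOf_addCode (q r : Code) : ratOf (addCode q r) = ratOf q + ratOf r := by
  simp only [ratOf, addCode]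
  push_cast
  field_simp
  ring

theorem ratOf_mulCode (q r : Code) : ratOf (mulCode q r) = ratOf q * ratOf r := by
  simp only [ratOf, mulCode]
  push_cast
  field_simp
  ring

theorem ratOf_lt_ratOf {q r : Code} :
    ratOf q < ratOf r ↔
      q.1 * (r.2.2 + 1) + r.2.1 * (q.2.2 + 1) < q.2.1 * (r.2.2 + 1) + r.1 * (q.2.2 + 1) := by
  rw [ratOf, ratOf, div_lt_div_iff₀ (by positivity) (by positivity), ← Nat.cast_lt (α := ℚ)]
  push_cast
  constructor <;> intro h <;> linarith

theorem computable_components {g : α → Code} (hg : Computable g) :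
    (Computable fun a => (g a).1) ∧ (Computable fun a => (g a).2.1) ∧
      Computable fun a => (g a).2.2 :=
  ⟨Computable.fst.comp hg, Computable.fst.comp (Computable.snd.comp hg),
    Computable.snd.comp (Computable.snd.comp hg)⟩

theorem computable_crossSum {u v c d : α → ℕ} (hu : Computable u) (hv : Computable v)
    (hc : Computable c) (hd : Computable d) :
    Computable fun a => u a * (d a + 1) + v a * (c a + 1) :=
  computable_nat_add (computable_nat_mul hu (Computable.succ.comp hd))
    (computable_nat_mul hv (Computable.succ.comp hc))

theorem computable_addCode {g h : α → Code} (hg : Computable g) (hh : Computable h) :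
    Computable fun a => addCode (g a) (h a) := by
  obtain ⟨hg1, hg2, hg3⟩ := computable_components hg
  obtain ⟨hh1, hh2, hh3⟩ := computable_components hh
  exact (computable_crossSum hg1 hh1 hg3 hh3).pair ((computable_crossSum hg2 hh2 hg3 hh3).pair
    (computable_nat_add (computable_nat_add (computable_nat_mul hg3 hh3) hg3) hh3))

theorem computable_mulCode {g h : α → Code} (hg : Computable g) (hh : Computable h) :
    Computable fun a => mulCode (g a) (h a) := by
  obtain ⟨hg1, hg2, hg3⟩ := computable_components hg
  obtain ⟨hh1, hh2, hh3⟩ := computable_components hh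
  exact (computable_nat_add (computable_nat_mul hg1 hh1) (computable_nat_mul hg2 hh2)).pair
    ((computable_nat_add (computable_nat_mul hg1 hh2) (computable_nat_mul hg2 hh1)).pair
      (computable_nat_add (computable_nat_add (computable_nat_mul hg3 hh3) hg3) hh3))

theorem ComputableRat.ratOf {g : α → Code} (hg : Computable g) :
    ComputableRat fun a => AlgRandom.ratOf (g a) :=
  ⟨g, hg, fun _ => rfl⟩

theorem ComputableRat.const (r : ℚ) : ComputableRat fun _ : α => r := by
  obtain ⟨q, rfl⟩ := ratOf_surjective r
  exact .ratOf (Computable.const q)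

theorem ComputableRat.natCast {f : α → ℕ} (hf : Computable f) :
    ComputableRat fun a => (f a : ℚ) :=
  ⟨fun a => (f a, 0, 0), hf.pair (Computable.const (0, 0)), fun a => by simp [AlgRandom.ratOf]⟩

theorem ComputableRat.comp {f : α → ℚ} (hf : ComputableRat f) {g : β → α} (hg : Computable g) :
    ComputableRat fun b => f (g b) := by
  obtain ⟨q, hq, hqf⟩ := hf
  exact ⟨_, hq.comp hg, fun b => hqf (g b)⟩

theorem ComputableRat.neg {f : α → ℚ} (hf : ComputableRat f) : ComputableRat fun a => -f a := by
  obtain ⟨g, hg, hgf⟩ := hf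
  obtain ⟨hg1, hg2, hg3⟩ := computable_components hg
  refine ⟨_, hg2.pair (hg1.pair hg3), fun a => ?_⟩
  simp only [← hgf, AlgRandom.ratOf]
  ring

theorem ComputableRat.add {f f' : α → ℚ} (hf : ComputableRat f) (hf' : ComputableRat f') :
    ComputableRat fun a => f a + f' a := by
  obtain ⟨g, hg, hgf⟩ := hf
  obtain ⟨g', hg', hgf'⟩ := hf'
  exact ⟨_, computable_addCode hg hg', fun a => by rw [ratOf_addCode, hgf, hgf']⟩

theorem ComputableRat.mul {f f' : α → ℚ} (hf : ComputableRat f) (hf' : ComputableRat f') :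
    ComputableRat fun a => f a * f' a := by
  obtain ⟨g, hg, hgf⟩ := hf
  obtain ⟨g', hg', hgf'⟩ := hf'
  exact ⟨_, computable_mulCode hg hg', fun a => by rw [ratOf_mulCode, hgf, hgf']⟩

theorem ComputableRat.pow {f : α → ℚ} (hf : ComputableRat f) {k : α → ℕ} (hk : Computable k) :
    ComputableRat fun a => f a ^ k a := by
  obtain ⟨g, hg, hgf⟩ := hf
  refine ⟨_, Computable.nat_rec (g := fun _ => (1, 0, 0)) (h := fun a q => mulCode q.2 (g a)) hk
    (Computable.const _) (computable_mulCode (Computable.snd.comp Computable.snd)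
      (hg.comp Computable.fst)), fun a => ?_⟩
  dsimp only
  induction k a with
  | zero => simp [AlgRandom.ratOf]
  | succ n ih => simp only [ratOf_mulCode, ih, hgf, pow_succ]

theorem ComputableRat.sum_range {f : α × ℕ → ℚ} (hf : ComputableRat f) {N : α → ℕ}
    (hN : Computable N) : ComputableRat fun a => ∑ i ∈ Finset.range (N a), f (a, i) := by
  obtain ⟨g, hg, hgf⟩ := hf
  refine ⟨_, Computable.nat_rec (g := fun _ => (0, 0, 0))
    (h := fun a q => addCode q.2 (g (a, q.1))) hN (Computable.const _)
    (computable_addCode (Computable.snd.comp Computable.snd)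
      (hg.comp (Computable.fst.pair (Computable.fst.comp Computable.snd)))), fun a => ?_⟩
  dsimp only
  induction N a with
  | zero => simp [AlgRandom.ratOf]
  | succ n ih => simp only [ratOf_addCode, ih, hgf, Finset.sum_range_succ]

theorem ComputableRat.lt {D : ℕ} {s : Seq D} {f f' : α → ℚ} (hf : ComputableRat f)
    (hf' : ComputableRat f') : CEIn s fun a => f a < f' a := by
  obtain ⟨g, hg, hgf⟩ := hf
  obtain ⟨h, hh, hhf⟩ := hf'
  obtain ⟨hg1, hg2, hg3⟩ := computable_components hg
  obtain ⟨hh1, hh2, hh3⟩ := computable_components hh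
  refine (CEIn.of_computable (Primrec.nat_lt.decide.to_comp.comp
    (computable_crossSum hg1 hh2 hg3 hh3) (computable_crossSum hg2 hh1 hg3 hh3))).of_eq fun a => ?_
  rw [← hgf, ← hhf, ratOf_lt_ratOf]
  simp

end ComputableRat

section RationalApproximation

theorem exists_rat_box_of_mem_nhds {x : ℝ} {u : Set ℝ} (hu : u ∈ 𝓝 x) :
    ∃ p q : ℚ, (p : ℝ) < x ∧ x < q ∧ Set.Icc (p : ℝ) q ⊆ u := by
  obtain ⟨a, b, ⟨hax, hxb⟩, hab⟩ := mem_nhds_iff_exists_Ioo_subset.1 hu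
  obtain ⟨p, hap, hpx⟩ := exists_rat_btwn hax
  obtain ⟨q, hxq, hqb⟩ := exists_rat_btwn hxb
  exact ⟨p, q, hpx, hxq, (Set.Icc_subset_Ioo hap hqb).trans hab⟩

theorem lt_mul_of_lt_mul_endpoints {c x y y₁ y₂ : ℝ} (hy₁ : y₁ ≤ y) (hy₂ : y ≤ y₂)
    (h₁ : c < x * y₁) (h₂ : c < x * y₂) : c < x * y := by
  rcases le_total 0 x with hx | hx
  · exact h₁.trans_le (mul_le_mul_of_nonneg_left hy₁ hx)
  · exact h₂.trans_le (mul_le_mul_of_nonpos_left hy₂ hx)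

theorem rat_lt_add_iff {c : ℚ} {x y : ℝ} :
    (c : ℝ) < x + y ↔ ∃ p q : ℚ, (p : ℝ) < x ∧ (q : ℝ) < y ∧ c < p + q := by
  constructor
  · intro h
    obtain ⟨p, hp, hpx⟩ := exists_rat_btwn (sub_lt_iff_lt_add.2 h)
    obtain ⟨q, hq, hqy⟩ := exists_rat_btwn (sub_lt_comm.1 hp)
    exact ⟨p, q, hpx, hqy, by exact_mod_cast sub_lt_iff_lt_add'.1 hq⟩
  · rintro ⟨p, q, hp, hq, hc⟩
    have : (c : ℝ) < p + q := mod_cast hc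
    linarith

/-- A product of intervals is bounded below by its values at the four corners. -/
theorem rat_lt_mul_iff {c : ℚ} {x y : ℝ} :
    (c : ℝ) < x * y ↔ ∃ p p' q q' : ℚ, ((p : ℝ) < x ∧ x < p') ∧ ((q : ℝ) < y ∧ y < q') ∧
      (c < p * q ∧ c < p * q') ∧ c < p' * q ∧ c < p' * q' := by
  constructor
  · intro h
    have hnhds : {z : ℝ × ℝ | (c : ℝ) < z.1 * z.2} ∈ 𝓝 (x, y) :=
      (isOpen_lt continuous_const continuous_mul).mem_nhds h
    obtain ⟨u, hu, v, hv, huv⟩ := mem_nhds_prod_iff.1 hnhds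
    obtain ⟨p, p', hpx, hxp, hp⟩ := exists_rat_box_of_mem_nhds hu
    obtain ⟨q, q', hqy, hyq, hq⟩ := exists_rat_box_of_mem_nhds hv
    have hpp := (hpx.trans hxp).le
    have hqq := (hqy.trans hyq).le
    have corner {r t : ℚ} (hr : (r : ℝ) ∈ Set.Icc (p : ℝ) p') (ht : (t : ℝ) ∈ Set.Icc (q : ℝ) q') :
        c < r * t := by
      have hlt : (c : ℝ) < r * t := huv (Set.mk_mem_prod (hp hr) (hq ht))
      exact_mod_cast hlt
    exact ⟨p, p', q, q', ⟨hpx, hxp⟩, ⟨hqy, hyq⟩,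
      ⟨corner ⟨le_rfl, hpp⟩ ⟨le_rfl, hqq⟩, corner ⟨le_rfl, hpp⟩ ⟨hqq, le_rfl⟩⟩,
      corner ⟨hpp, le_rfl⟩ ⟨le_rfl, hqq⟩, corner ⟨hpp, le_rfl⟩ ⟨hqq, le_rfl⟩⟩
  · rintro ⟨p, p', q, q', ⟨hpx, hxp⟩, ⟨hqy, hyq⟩, ⟨h₁₁, h₁₂⟩, h₂₁, h₂₂⟩
    have left : (c : ℝ) < p * y := lt_mul_of_lt_mul_endpoints hqy.le hyq.le
      (by exact_mod_cast h₁₁) (by exact_mod_cast h₁₂)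
    have right : (c : ℝ) < p' * y := lt_mul_of_lt_mul_endpoints hqy.le hyq.le
      (by exact_mod_cast h₂₁) (by exact_mod_cast h₂₂)
    rw [mul_comm] at left right ⊢
    exact lt_mul_of_lt_mul_endpoints hpx.le hxp.le left right

theorem rat_lt_pow_iff {c : ℚ} {x : ℝ} (hx : 0 < x) {k : ℕ} :
    (c : ℝ) < x ^ k ↔ ∃ p : ℚ, (p : ℝ) < x ∧ 0 < p ∧ c < p ^ k := by
  constructor
  · intro h
    have hnhds : {y : ℝ | 0 < y ∧ (c : ℝ) < y ^ k} ∈ 𝓝 x :=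
      ((isOpen_lt continuous_const continuous_id).inter
        (isOpen_lt continuous_const (continuous_pow k))).mem_nhds ⟨hx, h⟩
    obtain ⟨p, p', hpx, hxp, hp⟩ := exists_rat_box_of_mem_nhds hnhds
    obtain ⟨hp0, hpk⟩ := hp ⟨le_rfl, (hpx.trans hxp).le⟩
    exact ⟨p, hpx, by exact_mod_cast hp0, by exact_mod_cast hpk⟩
  · rintro ⟨p, hpx, hp, hc⟩
    have : (0 : ℝ) ≤ p := mod_cast hp.le
    exact (show (c : ℝ) < p ^ k from mod_cast hc).trans_le (by gcongr)

theorem pow_lt_rat_iff {c : ℚ} {x : ℝ} (hx : 0 < x) {k : ℕ} :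
    x ^ k < c ↔ ∃ p : ℚ, x < p ∧ p ^ k < c := by
  constructor
  · intro h
    obtain ⟨p, p', hpx, hxp, hp⟩ := exists_rat_box_of_mem_nhds
      ((isOpen_lt (continuous_pow k) continuous_const).mem_nhds h)
    have hlt : (p' : ℝ) ^ k < c := hp ⟨(hpx.trans hxp).le, le_rfl⟩
    exact ⟨p', hxp, by exact_mod_cast hlt⟩
  · rintro ⟨p, hxp, hc⟩
    exact (show x ^ k ≤ (p : ℝ) ^ k by gcongr).trans_lt (mod_cast hc)

theorem rat_lt_sum_range_iff {c : ℚ} {f : ℕ → ℝ} {n : ℕ} :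
    (c : ℝ) < ∑ i ∈ Finset.range n, f i ↔
      ∃ p : ℕ → ℚ, (∀ i < n, (p i : ℝ) < f i) ∧ c < ∑ i ∈ Finset.range n, p i := by
  constructor
  · intro h
    obtain ⟨δ, hδ, hδc⟩ : ∃ δ : ℝ, 0 < δ ∧ n * δ < ∑ i ∈ Finset.range n, f i - c := by
      refine ⟨(∑ i ∈ Finset.range n, f i - c) / (n + 1), by have := sub_pos.2 h; positivity, ?_⟩
      rw [mul_div_assoc', div_lt_iff₀ (by positivity)]
      linarith
    choose p hp using fun i => exists_rat_btwn (sub_lt_self (f i) hδ)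
    refine ⟨p, fun i _ => (hp i).2, ?_⟩
    have hsum : ∑ i ∈ Finset.range n, (f i - δ) ≤ ∑ i ∈ Finset.range n, (p i : ℝ) :=
      Finset.sum_le_sum fun i _ => (hp i).1.le
    rw [Finset.sum_sub_distrib, Finset.sum_const, Finset.card_range, nsmul_eq_mul] at hsum
    have hlt : (c : ℝ) < ∑ i ∈ Finset.range n, (p i : ℝ) := by linarith
    exact_mod_cast hlt
  · rintro ⟨p, hp, hc⟩
    calc (c : ℝ) < ∑ i ∈ Finset.range n, (p i : ℝ) := by exact_mod_cast hc
      _ ≤ ∑ i ∈ Finset.range n, f i :=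
        Finset.sum_le_sum fun i hi => (hp i (Finset.mem_range.1 hi)).le

theorem logb_two_mul_pow {x : ℝ} (hx : 0 < x) (b c : ℕ) :
    Real.logb 2 (2 ^ b * x ^ (c + 1)) = b + (c + 1) * Real.logb 2 x := by
  rw [Real.logb_mul (by positivity) (by positivity), Real.logb_pow, Real.logb_pow,
    Real.logb_self_eq_one one_lt_two]
  push_cast
  ring

theorem ratOf_lt_logb_iff {q : Code} {x : ℝ} (hx : 0 < x) :
    (ratOf q : ℝ) < Real.logb 2 x ↔ (2 : ℝ) ^ q.1 < 2 ^ q.2.1 * x ^ (q.2.2 + 1) := by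
  rw [← Real.rpow_natCast 2 q.1, ← Real.lt_logb_iff_rpow_lt one_lt_two (by positivity),
    logb_two_mul_pow hx, ratOf]
  push_cast
  rw [div_lt_iff₀' (by positivity), sub_lt_iff_lt_add']

theorem logb_lt_ratOf_iff {q : Code} {x : ℝ} (hx : 0 < x) :
    Real.logb 2 x < ratOf q ↔ 2 ^ q.2.1 * x ^ (q.2.2 + 1) < (2 : ℝ) ^ q.1 := by
  rw [← Real.rpow_natCast 2 q.1, ← Real.logb_lt_iff_lt_rpow one_lt_two (by positivity),
    logb_two_mul_pow hx, ratOf]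
  push_cast
  rw [lt_div_iff₀' (by positivity), lt_sub_iff_add_lt']

end RationalApproximation

section ComputableRealIn

variable {D : ℕ} {α β : Type} [Primcodable α] [Primcodable β] {s : Seq D}

/-- The version of `ComputableReal` relative to an oracle `s`: the values of `f` can be
approximated by rational numbers from both sides, uniformly effectively in `s`. -/
structure ComputableRealIn (s : Seq D) (f : α → ℝ) : Prop where
  ratOf_lt : CEIn s fun p : α × Code => ((ratOf p.2 : ℚ) : ℝ) < f p.1
  lt_ratOf : CEIn s fun p : α × Code => f p.1 < ((ratOf p.2 : ℚ) : ℝ)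

theorem ComputableReal.realIn {f : α → ℝ} (hf : ComputableReal f) : ComputableRealIn s f :=
  ⟨.of_rePred hf.1, .of_rePred hf.2⟩

theorem ComputableRealFunctional.realIn {f : Seq D → α → ℝ} (hf : ComputableRealFunctional f) :
    ComputableRealIn s (f s) := by
  obtain ⟨⟨V, hV, hlt⟩, W, hW, hgt⟩ := hf
  exact ⟨⟨V, hV, hlt s⟩, W, hW, hgt s⟩

namespace ComputableRealIn

variable {f g : α → ℝ}

theorem comp (hf : ComputableRealIn s f) {g : β → α} (hg : Computable g) :
    ComputableRealIn s fun b => f (g b) :=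
  ⟨hf.ratOf_lt.comp ((hg.comp Computable.fst).pair Computable.snd),
    hf.lt_ratOf.comp ((hg.comp Computable.fst).pair Computable.snd)⟩

theorem rat_lt (hf : ComputableRealIn s f) {r : α → ℚ} (hr : ComputableRat r) :
    CEIn s fun a => (r a : ℝ) < f a := by
  obtain ⟨q, hq, hqr⟩ := hr
  exact (hf.ratOf_lt.comp (Computable.id.pair hq)).of_eq fun a => by rw [← hqr, id]

theorem lt_rat (hf : ComputableRealIn s f) {r : α → ℚ} (hr : ComputableRat r) :
    CEIn s fun a => f a < r a := by
  obtain ⟨q, hq, hqr⟩ := hr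
  exact (hf.lt_ratOf.comp (Computable.id.pair hq)).of_eq fun a => by rw [← hqr, id]

theorem of_rat {r : α → ℚ} (hr : ComputableRat r) : ComputableRealIn s fun a => (r a : ℝ) := by
  have hq := ComputableRat.ratOf (Computable.snd (α := α) (β := Code))
  have hr' := hr.comp (Computable.fst (α := α) (β := Code))
  exact ⟨(hq.lt hr').of_eq fun p => by norm_cast, (hr'.lt hq).of_eq fun p => by norm_cast⟩

theorem lt (hf : ComputableRealIn s f) (hg : ComputableRealIn s g) :
    CEIn s fun a => f a < g a := by
  refine ((hf.lt_ratOf).and hg.ratOf_lt).exists.of_eq fun a => ?_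
  rw [← ratOf_surjective.exists (p := fun r : ℚ => f a < r ∧ (r : ℝ) < g a)]
  exact ⟨fun ⟨r, hfr, hrg⟩ => hfr.trans hrg, exists_rat_btwn⟩

theorem neg (hf : ComputableRealIn s f) : ComputableRealIn s fun a => -f a := by
  have hq := (ComputableRat.ratOf (Computable.snd (α := α) (β := Code))).neg
  have hf' := hf.comp (Computable.fst (α := α) (β := Code))
  constructor
  · exact (hf'.lt_rat hq).of_eq fun p => by push_cast; exact lt_neg
  · exact (hf'.rat_lt hq).of_eq fun p => by push_cast; exact neg_lt

theorem of_ratOf_lt (hf : CEIn s fun p : α × Code => ((ratOf p.2 : ℚ) : ℝ) < f p.1)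
    (hf' : CEIn s fun p : α × Code => ((ratOf p.2 : ℚ) : ℝ) < -f p.1) :
    ComputableRealIn s f := by
  obtain ⟨q, hq, hqr⟩ := (ComputableRat.ratOf (Computable.snd (α := α) (β := Code))).neg
  exact ⟨hf, (hf'.comp (Computable.fst.pair hq)).of_eq fun p => by
    rw [hqr]; push_cast; exact neg_lt_neg_iff⟩

theorem ratOf_lt_add (hf : ComputableRealIn s f) (hg : ComputableRealIn s g) :
    CEIn s fun p : α × Code => ((ratOf p.2 : ℚ) : ℝ) < f p.1 + g p.1 := by
  have ctx := Computable.fst (α := α × Code) (β := Code × Code)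
  have approx := Computable.snd (α := α × Code) (β := Code × Code)
  have hc := ComputableRat.ratOf (Computable.snd.comp ctx)
  have hp := ComputableRat.ratOf (Computable.fst.comp approx)
  have hq := ComputableRat.ratOf (Computable.snd.comp approx)
  refine (((hf.comp (Computable.fst.comp ctx)).rat_lt hp).and
    (((hg.comp (Computable.fst.comp ctx)).rat_lt hq).and (hc.lt (hp.add hq)))).exists.of_eq
      fun a => ?_
  simp only [rat_lt_add_iff, Prod.exists, ratOf_surjective.exists]

theorem ratOf_lt_mul (hf : ComputableRealIn s f) (hg : ComputableRealIn s g) :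
    CEIn s fun p : α × Code => ((ratOf p.2 : ℚ) : ℝ) < f p.1 * g p.1 := by
  have ctx := Computable.fst (α := α × Code) (β := (Code × Code) × Code × Code)
  have box := Computable.snd (α := α × Code) (β := (Code × Code) × Code × Code)
  have hc := ComputableRat.ratOf (Computable.snd.comp ctx)
  have hp := ComputableRat.ratOf (Computable.fst.comp (Computable.fst.comp box))
  have hp' := ComputableRat.ratOf (Computable.snd.comp (Computable.fst.comp box))
  have hq := ComputableRat.ratOf (Computable.fst.comp (Computable.snd.comp box))
  have hq' := ComputableRat.ratOf (Computable.snd.comp (Computable.snd.comp box))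
  have hf' := hf.comp (Computable.fst.comp ctx)
  have hg' := hg.comp (Computable.fst.comp ctx)
  refine (((hf'.rat_lt hp).and (hf'.lt_rat hp')).and (((hg'.rat_lt hq).and (hg'.lt_rat hq')).and
    (((hc.lt (hp.mul hq)).and (hc.lt (hp.mul hq'))).and
      ((hc.lt (hp'.mul hq)).and (hc.lt (hp'.mul hq')))))).exists.of_eq fun a => ?_
  simp only [rat_lt_mul_iff, Prod.exists, ratOf_surjective.exists]

theorem add (hf : ComputableRealIn s f) (hg : ComputableRealIn s g) :
    ComputableRealIn s fun a => f a + g a :=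
  .of_ratOf_lt (hf.ratOf_lt_add hg) ((hf.neg.ratOf_lt_add hg.neg).of_eq fun p => by rw [neg_add])

theorem mul (hf : ComputableRealIn s f) (hg : ComputableRealIn s g) :
    ComputableRealIn s fun a => f a * g a :=
  .of_ratOf_lt (hf.ratOf_lt_mul hg) ((hf.neg.ratOf_lt_mul hg).of_eq fun p => by rw [neg_mul])

theorem finset_sum {ι : Type*} {F : ι → α → ℝ} (t : Finset ι)
    (hF : ∀ i ∈ t, ComputableRealIn s (F i)) : ComputableRealIn s fun a => ∑ i ∈ t, F i a := by
  classical
  induction t using Finset.induction_on with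
  | empty => simpa using of_rat (s := s) (α := α) (.const 0)
  | insert i t hi ih =>
    rw [Finset.forall_mem_insert] at hF
    simpa only [Finset.sum_insert hi] using hF.1.add (ih hF.2)

theorem pow (hf : ComputableRealIn s f) (hpos : ∀ a, 0 < f a) {k : α → ℕ} (hk : Computable k) :
    ComputableRealIn s fun a => f a ^ k a := by
  have ctx := Computable.fst (α := α × Code) (β := Code)
  have hf' := hf.comp (Computable.fst.comp ctx)
  have hc := ComputableRat.ratOf (Computable.snd.comp ctx)
  have hp := ComputableRat.ratOf (Computable.snd (α := α × Code) (β := Code))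
  have hpk := hp.pow (hk.comp (Computable.fst.comp ctx))
  constructor
  · refine ((hf'.rat_lt hp).and (((ComputableRat.const 0).lt hp).and (hc.lt hpk))).exists.of_eq
      fun a => ?_
    simp only [rat_lt_pow_iff (hpos _), ratOf_surjective.exists]
  · refine ((hf'.lt_rat hp).and (hpk.lt hc)).exists.of_eq fun a => ?_
    simp only [pow_lt_rat_iff (hpos _), ratOf_surjective.exists]

theorem logb_two (hf : ComputableRealIn s f) (hpos : ∀ a, 0 < f a) :
    ComputableRealIn s fun a => Real.logb 2 (f a) := by
  have two_pow {k : α × Code → ℕ} (hk : Computable k) :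
      ComputableRealIn s fun p => (2 : ℝ) ^ k p :=
    pow (by simpa using of_rat (s := s) (.const 2)) (fun _ => two_pos) hk
  obtain ⟨ha, hb, hc⟩ := computable_components (Computable.snd (α := α) (β := Code))
  have hfc := (hf.comp Computable.fst).pow (fun p => hpos p.1) (Computable.succ.comp hc)
  constructor
  · exact ((two_pow ha).lt ((two_pow hb).mul hfc)).of_eq fun p => (ratOf_lt_logb_iff (hpos _)).symm
  · exact (((two_pow hb).mul hfc).lt (two_pow ha)).of_eq fun p => (logb_lt_ratOf_iff (hpos _)).symm

end ComputableRealIn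

-- The witnesses are lists of codes of rational lower bounds of the summands.
theorem CEIn.lt_sum_range {U : α × ℕ → Prop} {f : α × ℕ → ℝ}
    (hf : CEIn s fun p : (α × ℕ) × Code => U p.1 ∧ ((ratOf p.2 : ℚ) : ℝ) < f p.1)
    {r : α → ℚ} (hr : ComputableRat r) {N : α → ℕ} (hN : Computable N) :
    CEIn s fun a => (∀ i < N a, U (a, i)) ∧ (r a : ℝ) < ∑ i ∈ Finset.range (N a), f (a, i) := by
  have ctx := Computable.fst (α := α) (β := List Code)
  have entry : Computable fun p : (α × List Code) × ℕ => p.1.2.getD p.2 (0, 0, 0) :=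
    (Primrec.list_getD _).to_comp.comp (Computable.snd.comp Computable.fst) Computable.snd
  have bounds := (hf.comp (((Computable.fst.comp Computable.fst).pair Computable.snd).pair
    entry)).forall_lt (hN.comp ctx)
  have total := (hr.comp ctx).lt (s := s) ((ComputableRat.ratOf entry).sum_range (hN.comp ctx))
  refine (bounds.and total).exists.of_eq fun a => ?_
  simp only [rat_lt_sum_range_iff, forall_and, and_assoc, exists_and_left]
  refine and_congr_right fun _ => ⟨fun ⟨l, hl, hsum⟩ => ⟨_, hl, hsum⟩, ?_⟩
  rintro ⟨p, hp, hsum⟩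
  choose c hc using fun i => ratOf_surjective (p i)
  have hentry : ∀ i < N a, ratOf (((List.range (N a)).map c).getD i (0, 0, 0)) = p i :=
    fun i hi => by simp [List.getD, List.getElem?_range hi, hc]
  refine ⟨(List.range (N a)).map c, fun i hi => by rw [hentry i hi]; exact hp i hi, ?_⟩
  rwa [Finset.sum_congr rfl fun i hi => hentry i (Finset.mem_range.1 hi)]

end ComputableRealIn

section Words

variable {D : ℕ} (P : Measure (Seq D))

theorem word_succ (x : Seq D) (j : ℤ) (n : ℕ) : word x j (n + 1) = word x j n ++ [x (j + n)] := by
  simp [word, List.range_succ]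

theorem take_word (x : Seq D) (j : ℤ) {i n : ℕ} (h : i ≤ n) :
    (word x j n).take i = word x j i := by
  simp [word, ← List.map_take, List.take_range, h]

theorem cylinder_nil (w : Str D) : cylinder [] w = {x | word x 1 w.length = w} := by
  simp [cylinder]

theorem prob_nonneg (w : Str D) : 0 ≤ prob P w := measureReal_nonneg

theorem setOf_word_concat (w : Str D) (a : Fin D) :
    {x : Seq D | word x 1 (w ++ [a]).length = w ++ [a]} =
      {x | word x 1 w.length = w} ∩ {x | x (1 + w.length) = a} := by
  ext x
  simp [word_succ]

/-- The coordinates `X_1, …, X_n`, which generate the information available after `n` letters. -/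
def firstLetters (n : ℕ) (y : Seq D) : Fin n → Fin D := fun i => y (1 + (i : ℕ))

theorem measurable_firstLetters (n : ℕ) : Measurable (firstLetters n : Seq D → Fin n → Fin D) :=
  measurable_pi_lambda _ fun _ => measurable_pi_apply _

theorem ofFn_firstLetters (n : ℕ) (y : Seq D) : List.ofFn (firstLetters n y) = word y 1 n := by
  apply List.ext_getElem <;> simp [word, firstLetters]

theorem firstLetters_eq_iff {n : ℕ} {v : Fin n → Fin D} {y : Seq D} :
    firstLetters n y = v ↔ word y 1 n = List.ofFn v := by
  rw [← ofFn_firstLetters, List.ofFn_inj]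

theorem measurableSet_word (w : Str D) : MeasurableSet {x : Seq D | word x 1 w.length = w} := by
  have h := measurable_firstLetters w.length (measurableSet_singleton w.get)
  simpa only [Set.preimage, Set.mem_singleton_iff, firstLetters_eq_iff, List.ofFn_get] using h

theorem sum_prob_concat [IsFiniteMeasure P] (w : Str D) :
    ∑ a, prob P (w ++ [a]) = prob P w := by
  simp only [prob, setOf_word_concat]
  have hcoord (a : Fin D) : MeasurableSet {x : Seq D | x (1 + w.length) = a} :=
    measurableSet_eq_fun (measurable_pi_apply _) measurable_const
  rw [← measureReal_biUnion_finset ?_ fun a _ => (measurableSet_word w).inter (hcoord a)]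
  · congr 1
    ext x
    simp
  · intro a _ b _ hab
    exact Set.disjoint_left.2 fun x ha hb => hab (ha.2.symm.trans hb.2)

theorem prob_append_le [IsFiniteMeasure P] (w u : Str D) : prob P (w ++ u) ≤ prob P w :=
  measureReal_mono fun y hy => by simpa [take_word] using congrArg (List.take w.length) hy

theorem condProb_nonneg (w : Str D) (a : Fin D) : 0 ≤ condProb P w a :=
  div_nonneg (prob_nonneg P _) (prob_nonneg P _)

theorem prob_mul_condProb [IsFiniteMeasure P] (w : Str D) (a : Fin D) :
    prob P w * condProb P w a = prob P (w ++ [a]) :=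
  mul_div_cancel_of_imp' fun h => le_antisymm (h ▸ prob_append_le P w [a]) (prob_nonneg P _)

theorem sum_condProb_le_one [IsFiniteMeasure P] (w : Str D) : ∑ a, condProb P w a ≤ 1 := by
  simp only [condProb]
  rw [← Finset.sum_div, sum_prob_concat]
  exact div_self_le_one _

end Words

section CondMean

/-- The conditional expectation of `f (X_1^{n+1})` given `X_1^n = w`, where `n` is the length of
`w`; it is `0` if `w` has probability `0`. -/
noncomputable def condMean {D : ℕ} (P : Measure (Seq D)) (f : Str D → ℝ) (w : Str D) : ℝ :=
  ∑ a, condProb P w a * f (w ++ [a])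

variable {D : ℕ} (P : Measure (Seq D)) [IsFiniteMeasure P]

theorem prob_mul_condMean (f : Str D → ℝ) (w : Str D) :
    prob P w * condMean P f w = ∑ a, prob P (w ++ [a]) * f (w ++ [a]) := by
  simp only [condMean, Finset.mul_sum, ← mul_assoc, prob_mul_condProb]

theorem abs_condMean_le {f : Str D → ℝ} {w : Str D} {b : ℝ} (hb : 0 ≤ b)
    (hf : ∀ a, |f (w ++ [a])| ≤ b) : |condMean P f w| ≤ b :=
  calc |condMean P f w| ≤ ∑ a, |condProb P w a * f (w ++ [a])| := Finset.abs_sum_le_sum_abs _ _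
    _ ≤ ∑ a, condProb P w a * b := by
      refine Finset.sum_le_sum fun a _ => ?_
      rw [abs_mul, abs_of_nonneg (condProb_nonneg P w a)]
      exact mul_le_mul_of_nonneg_left (hf a) (condProb_nonneg P w a)
    _ ≤ b := by
      rw [← Finset.sum_mul]
      exact mul_le_of_le_one_left hb (sum_condProb_le_one P w)

theorem integral_comp_word (g : Str D → ℝ) (n : ℕ) :
    ∫ y, g (word y 1 n) ∂P = ∑ v : Fin n → Fin D, prob P (List.ofFn v) * g (List.ofFn v) := by
  have hmap (v : Fin n → Fin D) : (P.map (firstLetters n)).real {v} = prob P (List.ofFn v) := by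
    rw [map_measureReal_apply (measurable_firstLetters n) (measurableSet_singleton v)]
    simp only [prob, List.length_ofFn, ← firstLetters_eq_iff]
    rfl
  simp only [← ofFn_firstLetters]
  rw [← integral_map (f := fun v => g (List.ofFn v)) (measurable_firstLetters n).aemeasurable
    (measurable_of_finite _).aestronglyMeasurable, integral_fintype .of_finite]
  simp only [hmap, smul_eq_mul]

theorem sum_words_succ (g : Str D → ℝ) (n : ℕ) :
    ∑ v : Fin (n + 1) → Fin D, g (List.ofFn v) =
      ∑ v : Fin n → Fin D, ∑ a, g (List.ofFn v ++ [a]) := by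
  rw [← (Fin.snocEquiv fun _ : Fin (n + 1) => Fin D).sum_comp, Fintype.sum_prod_type,
    Finset.sum_comm]
  simp only [List.ofFn_succ', List.concat_eq_append, Fin.snocEquiv, Equiv.coe_fn_mk,
    Fin.snoc_castSucc, Fin.snoc_last]

theorem integral_comp_word_succ (g : Str D → ℝ) (n : ℕ) :
    ∫ y, g (word y 1 (n + 1)) ∂P = ∫ y, condMean P g (word y 1 n) ∂P := by
  rw [integral_comp_word, integral_comp_word, sum_words_succ (fun w => prob P w * g w)]
  simp only [prob_mul_condMean]

/-- The filtration of the σ-algebras generated by `X_1, …, X_n`. -/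
def letterFiltration (D : ℕ) : Filtration ℕ (inferInstance : MeasurableSpace (Seq D)) where
  seq n := MeasurableSpace.comap (firstLetters n) inferInstance
  mono' m n h := by
    have hcomp : (firstLetters m : Seq D → Fin m → Fin D) =
        (fun v i => v (Fin.castLE h i)) ∘ firstLetters n := rfl
    simp only [hcomp, ← MeasurableSpace.comap_comp]
    exact MeasurableSpace.comap_mono
      (measurable_pi_lambda _ fun _ => measurable_pi_apply _).comap_le
  le' n := (measurable_firstLetters n).comap_le

theorem stronglyMeasurable_comp_word (g : Str D → ℝ) (n : ℕ) :
    StronglyMeasurable[letterFiltration D n] fun y => g (word y 1 n) := by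
  simp only [← ofFn_firstLetters]
  exact ((measurable_of_finite fun v => g (List.ofFn v)).comp
    (comap_measurable (firstLetters n))).stronglyMeasurable

theorem integrable_comp_word (g : Str D → ℝ) (n : ℕ) : Integrable (fun y => g (word y 1 n)) P := by
  simp only [← ofFn_firstLetters]
  exact (Integrable.of_finite (μ := P.map (firstLetters n))
    (f := fun v => g (List.ofFn v))).comp_measurable (measurable_firstLetters n)

theorem condExp_comp_word_succ (f : Str D → ℝ) (n : ℕ) :
    P[fun y => f (word y 1 (n + 1)) | letterFiltration D n] =ᵐ[P]
      fun y => condMean P f (word y 1 n) := by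
  classical
  refine (ae_eq_condExp_of_forall_setIntegral_eq ((letterFiltration D).le n)
    (integrable_comp_word P f (n + 1))
    (fun _ _ _ => (integrable_comp_word P (condMean P f) n).integrableOn) ?_
    (stronglyMeasurable_comp_word _ n).aestronglyMeasurable).symm
  rintro _ ⟨T, hT, rfl⟩ -
  let g : Str D → ℝ := fun w => if ∃ v ∈ T, w.dropLast = List.ofFn v then f w else 0
  have hmem (y : Seq D) : (∃ v ∈ T, word y 1 n = List.ofFn v) ↔ y ∈ firstLetters n ⁻¹' T := by
    simp [← ofFn_firstLetters]
  have hg (y : Seq D) : g (word y 1 (n + 1)) =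
      (firstLetters n ⁻¹' T).indicator (fun y => f (word y 1 (n + 1))) y := by
    simp only [g, word_succ, List.dropLast_concat, hmem, Set.indicator_apply]
  have hcond (y : Seq D) : condMean P g (word y 1 n) =
      (firstLetters n ⁻¹' T).indicator (fun y => condMean P f (word y 1 n)) y := by
    simp only [g, condMean, List.dropLast_concat, hmem, Set.indicator_apply]
    split_ifs <;> simp
  have hS := measurable_firstLetters n hT
  rw [← integral_indicator hS, ← integral_indicator hS, ← funext hg, ← funext hcond,
    integral_comp_word_succ]

end CondMean

section AzumaHoeffding

open ProbabilityTheory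

theorem hasCondSubgaussianMGF_of_mem_Icc_of_condExp_eq_zero {Ω : Type*} {m mΩ : MeasurableSpace Ω}
    [StandardBorelSpace Ω] {μ : Measure Ω} [IsFiniteMeasure μ] (hm : m ≤ mΩ) {X : Ω → ℝ}
    (hX : Measurable X) {a b : ℝ} (hab : ∀ ω, X ω ∈ Set.Icc a b) (hc : μ[X | m] =ᵐ[μ] 0) :
    HasCondSubgaussianMGF m hm X ((‖b - a‖₊ / 2) ^ 2) μ := by
  have hint : Integrable X μ := .of_mem_Icc a b hX.aemeasurable (.of_forall hab)
  have hmean : μ[X | m] =ᵐ[μ.trim hm] 0 :=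
    stronglyMeasurable_condExp.ae_eq_trim_of_stronglyMeasurable hm stronglyMeasurable_zero hc
  refine ⟨fun t => ?_, ?_⟩
  · rw [condExpKernel_comp_trim]
    exact integrable_exp_mul_of_mem_Icc hX.aemeasurable (.of_forall hab)
  · filter_upwards [hmean, condExp_ae_eq_trim_integral_condExpKernel hm hint] with ω h0 hω
    have : Nonempty Ω := ⟨ω⟩
    exact (hasSubgaussianMGF_of_mem_Icc_of_integral_eq_zero hX.aemeasurable (.of_forall hab)
      (hω.symm.trans h0)).mgf_le

variable {D : ℕ} {P : Measure (Seq D)} [IsProbabilityMeasure P] {d : Str D → ℝ} {b : ℕ → ℝ}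

theorem hasSubgaussianMGF_sum_range (hb : ∀ w a, |d (w ++ [a])| ≤ b w.length)
    (hd : ∀ w, condMean P d w = 0) (n : ℕ) :
    HasSubgaussianMGF (fun y => ∑ i ∈ Finset.range n, d (word y 1 (i + 1)))
      (∑ i ∈ Finset.range n, ‖b i‖₊ ^ 2) P := by
  induction n with
  | zero => simp
  | succ n ih =>
    have hmem (y : Seq D) : d (word y 1 (n + 1)) ∈ Set.Icc (-b n) (b n) := by
      simpa [word_succ, abs_le] using hb (word y 1 n) (y (1 + n))
    have hincr : HasCondSubgaussianMGF (letterFiltration D n) ((letterFiltration D).le n)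
        (fun y => d (word y 1 (n + 1))) (‖b n‖₊ ^ 2) P := by
      have hzero : P[fun y => d (word y 1 (n + 1)) | letterFiltration D n] =ᵐ[P] 0 := by
        simpa only [hd] using! condExp_comp_word_succ P d n
      have h := hasCondSubgaussianMGF_of_mem_Icc_of_condExp_eq_zero ((letterFiltration D).le n)
        ((stronglyMeasurable_comp_word d (n + 1)).mono
          ((letterFiltration D).le (n + 1))).measurable hmem hzero
      convert h using 2
      rw [sub_neg_eq_add, ← two_mul, nnnorm_mul]
      simp
    have hpast : Measurable[letterFiltration D n]
        fun y => ∑ i ∈ Finset.range n, d (word y 1 (i + 1)) :=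
      Finset.measurable_fun_sum _ fun i hi => ((stronglyMeasurable_comp_word d (i + 1)).mono
        ((letterFiltration D).mono (Finset.mem_range.1 hi))).measurable
    simp only [Finset.sum_range_succ]
    exact (ih.trim ((letterFiltration D).le n) hpast).add_of_hasCondSubgaussianMGF _ hincr

theorem measureReal_lt_sum_range_le (hb : ∀ w a, |d (w ++ [a])| ≤ b w.length)
    (hd : ∀ w, condMean P d w = 0) (r : ℝ) {t : ℝ} (ht : 0 ≤ t) (n : ℕ) :
    P.real {y | r < ∑ i ∈ Finset.range n, d (word y 1 (i + 1))} ≤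
      Real.exp (t ^ 2 / 2 * ∑ i ∈ Finset.range n, b i ^ 2 - t * r) := by
  have hsub := hasSubgaussianMGF_sum_range hb hd n
  calc _ ≤ P.real {y | r ≤ ∑ i ∈ Finset.range n, d (word y 1 (i + 1))} :=
        measureReal_mono (Set.ofPred_subset_ofPred.2 fun _ => le_of_lt)
    _ ≤ Real.exp (-t * r) * mgf (fun y => ∑ i ∈ Finset.range n, d (word y 1 (i + 1))) P t :=
        measure_ge_le_exp_mul_mgf r ht (hsub.integrable_exp_mul t)
    _ ≤ Real.exp (-t * r) * Real.exp ((∑ i ∈ Finset.range n, b i ^ 2) * t ^ 2 / 2) := by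
        gcongr
        simpa using hsub.mgf_le t
    _ = _ := by
        rw [← Real.exp_add]
        congr 1
        ring

theorem eventually_measureReal_lt_sum_range_le (hb : ∀ w a, |d (w ++ [a])| ≤ b w.length)
    (hd : ∀ w, condMean P d w = 0)
    (hsum : (fun n : ℕ => ∑ i ∈ Finset.range n, b i ^ 2) =o[atTop]
      fun n : ℕ => (n : ℝ) ^ 2 / Real.log n) :
    ∀ᶠ n : ℕ in atTop, P.real {y | (n : ℝ) < ∑ i ∈ Finset.range n, d (word y 1 (i + 1))} ≤
      1 / (n * (n + 1)) := by
  filter_upwards [hsum.def (show (0 : ℝ) < 1 / 8 by norm_num), eventually_ge_atTop 2] with n hn hn2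
  have hn0 : (2 : ℝ) ≤ n := by exact_mod_cast hn2
  have hlog : 0 < Real.log n := Real.log_pos (by linarith)
  rw [Real.norm_of_nonneg (Finset.sum_nonneg fun i _ => sq_nonneg (b i)),
    Real.norm_of_nonneg (by positivity)] at hn
  have hexp : (4 * Real.log n / n) ^ 2 / 2 * ∑ i ∈ Finset.range n, b i ^ 2 -
      4 * Real.log n / n * n ≤ -(3 * Real.log n) :=
    calc _ ≤ (4 * Real.log n / n) ^ 2 / 2 * (1 / 8 * ((n : ℝ) ^ 2 / Real.log n)) -
          4 * Real.log n / n * n := by gcongr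
      _ = -(3 * Real.log n) := by field_simp; ring
  calc _ ≤ Real.exp (-(3 * Real.log n)) :=
        (measureReal_lt_sum_range_le hb hd n (t := 4 * Real.log n / n) (by positivity) n).trans
          (Real.exp_le_exp.2 hexp)
    _ = 1 / (n : ℝ) ^ 3 := by
        rw [Real.exp_neg, mul_comm, Real.exp_mul, Real.exp_log (by linarith), one_div]
        norm_cast
    _ ≤ 1 / (n * (n + 1)) :=
        one_div_le_one_div_of_le (by positivity) (by nlinarith [sq_nonneg (n : ℝ)])

end AzumaHoeffding

section Growth

theorem div_log_le_two_mul_div_log {m n : ℕ} (h : m ≤ n) :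
    (m : ℝ) / Real.log m ≤ 2 * (n / Real.log n) := by
  rcases lt_or_ge m 2 with hm | hm
  · have hzero : (m : ℝ) / Real.log m = 0 := by interval_cases m <;> simp
    rw [hzero]
    positivity
  · have hm0 : (2 : ℝ) ≤ m := by exact_mod_cast hm
    have hmn : (m : ℝ) ≤ n := by exact_mod_cast h
    have hlogm : 1 / 2 < Real.log m :=
      (by linarith [Real.log_two_gt_d9] : 1 / 2 < Real.log 2).trans_le
        (Real.log_le_log two_pos hm0)
    have hlogn : Real.log n ≤ Real.log m + n / m - 1 := by
      have hratio : (0 : ℝ) < n / m := div_pos (by linarith) (by linarith)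
      have := Real.log_le_sub_one_of_pos hratio
      rw [Real.log_div (by linarith) (by linarith)] at this
      linarith
    rw [← mul_div_assoc, div_le_div_iff₀ (by linarith) (Real.log_pos (by linarith))]
    calc (m : ℝ) * Real.log n ≤ m * (Real.log m + n / m - 1) := by gcongr
      _ = m * Real.log m + (n - m) := by field_simp; ring
      _ ≤ 2 * n * Real.log m := by nlinarith

theorem isLittleO_sum_range_sq {b : ℕ → ℝ}
    (hb : b =o[atTop] fun n : ℕ => Real.sqrt (n / Real.log n)) :
    (fun n : ℕ => ∑ i ∈ Finset.range n, b i ^ 2) =o[atTop]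
      fun n : ℕ => (n : ℝ) ^ 2 / Real.log n := by
  have hg : ∀ n : ℕ, 0 ≤ (n : ℝ) / Real.log n := fun n => by positivity
  have hsq : (fun n => b n ^ 2) =o[atTop] fun n : ℕ => (n : ℝ) / Real.log n := by
    simpa only [Real.sq_sqrt (hg _)] using hb.pow two_pos
  have hdiv : Tendsto (fun n : ℕ => ∑ i ∈ Finset.range n, (i : ℝ) / Real.log i) atTop atTop := by
    refine (not_summable_iff_tendsto_nat_atTop_of_nonneg hg).1 fun hs => ?_
    obtain ⟨n, hn, hn2⟩ := ((hs.tendsto_atTop_zero.eventually_lt_const one_pos).and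
      (eventually_ge_atTop 2)).exists
    have hn0 : (1 : ℝ) < n := by exact_mod_cast hn2
    exact hn.not_ge ((one_le_div (Real.log_pos hn0)).2 (Real.log_le_self (by linarith)))
  refine (hsq.sum_range hg hdiv).trans_isBigO (.of_bound 2 (.of_forall fun n => ?_))
  rw [Real.norm_of_nonneg (Finset.sum_nonneg fun i _ => hg i),
    Real.norm_of_nonneg (by positivity)]
  calc ∑ i ∈ Finset.range n, (i : ℝ) / Real.log i
      ≤ ∑ _i ∈ Finset.range n, 2 * ((n : ℝ) / Real.log n) :=
        Finset.sum_le_sum fun i hi => div_log_le_two_mul_div_log (Finset.mem_range.1 hi).le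
    _ = 2 * ((n : ℝ) ^ 2 / Real.log n) := by
        rw [Finset.sum_const, Finset.card_range, nsmul_eq_mul]
        ring

end Growth

section Tests

variable {D : ℕ} {s : Seq D} {P : Measure (Seq D)} {x : Seq D}

theorem IsRandomRel.exists_forall_not (hx : IsRandomRel s P x) {E : ℕ × Str D → Prop}
    (hE : CEIn s E) (hP : ∀ k, P.real {y | ∃ n, E (k, word y 1 n)} ≤ 2⁻¹ ^ k) :
    ∃ k, ∀ n, ¬E (k, word x 1 n) := by
  have hU (k : ℕ) : {y : Seq D | ∃ n, E (k, word y 1 n)} =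
      {y | ∃ p ∈ {p : Str D × Str D | p.1 = [] ∧ E (k, p.2)}, y ∈ cylinder p.1 p.2} := by
    ext y
    constructor
    · rintro ⟨n, hn⟩
      exact ⟨([], word y 1 n), ⟨rfl, hn⟩, by simp [cylinder_nil]⟩
    · rintro ⟨⟨σ, τ⟩, ⟨rfl, hτ⟩, hy⟩
      rw [cylinder_nil] at hy
      exact ⟨τ.length, by rwa [hy]⟩
  have hempty : CEIn s fun p : ℕ × (Str D × Str D) => p.2.1 = [] :=
    .eq (Computable.fst.comp Computable.snd) (Computable.const [])
  have hCE := hempty.and (hE.comp (Computable.fst.pair (Computable.snd.comp Computable.snd)))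
  simpa using hx _ ⟨⟨_, hCE, hU⟩, hP⟩

theorem IsRandomRel.prob_pos (hx : IsRandomRel s P x) (n : ℕ) : 0 < prob P (word x 1 n) := by
  refine (prob_nonneg P _).lt_of_ne' fun hzero => ?_
  have hE : CEIn s fun p : ℕ × Str D => p.2 = word x 1 n :=
    .eq Computable.snd (Computable.const _)
  obtain ⟨k, hk⟩ := hx.exists_forall_not hE fun k => by
    have hset : {y : Seq D | ∃ m, word y 1 m = word x 1 n} =
        {y | word y 1 (word x 1 n).length = word x 1 n} := by
      ext y
      constructor
      · rintro ⟨m, hm⟩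
        obtain rfl : m = n := by simpa using congrArg List.length hm
        simpa using hm
      · exact fun hy => ⟨_, hy⟩
    rw [hset]
    exact hzero.trans_le (by positivity)
  exact hk n rfl

theorem measureReal_exists_ge_le {Ω : Type*} [MeasurableSpace Ω] {μ : Measure Ω}
    [IsFiniteMeasure μ] {A : ℕ → Set Ω} {N : ℕ} (hN : 0 < N)
    (hA : ∀ n, N ≤ n → μ.real (A n) ≤ 1 / (n * (n + 1))) :
    μ.real {y | ∃ n, N ≤ n ∧ y ∈ A n} ≤ 1 / N := by
  have hfin (M : ℕ) : μ.real (⋃ n ∈ Finset.Ico N (N + M), A n) ≤ 1 / N - 1 / (N + M : ℕ) := by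
    induction M with
    | zero => simp
    | succ M ih =>
      have : (0 : ℝ) < (N + M : ℕ) := by positivity
      rw [← add_assoc, Nat.Ico_succ_right_eq_insert_Ico (by lia), Finset.set_biUnion_insert,
        Set.union_comm]
      calc _ ≤ 1 / N - 1 / ((N + M : ℕ) : ℝ) + 1 / ((N + M : ℕ) * ((N + M : ℕ) + 1)) :=
            (measureReal_union_le _ _).trans (add_le_add ih (hA _ (by lia)))
        _ = _ := by
            rw [Nat.cast_succ]
            field_simp
            ring
  have hset : {y | ∃ n, N ≤ n ∧ y ∈ A n} = ⋃ M : ℕ, ⋃ n ∈ Finset.Ico N (N + M), A n := by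
    ext y
    simp only [Set.mem_ofPred_eq, Set.mem_iUnion, Finset.mem_Ico, exists_prop]
    exact ⟨fun ⟨n, hn, hy⟩ => ⟨n + 1, n, ⟨hn, by lia⟩, hy⟩, fun ⟨_, n, ⟨hn, _⟩, hy⟩ => ⟨n, hn, hy⟩⟩
  have hmono : Monotone fun M => ⋃ n ∈ Finset.Ico N (N + M), A n := fun M M' h =>
    Set.biUnion_mono (Finset.Ico_subset_Ico le_rfl (by lia)) fun _ _ => subset_rfl
  have hlim : Tendsto (fun M => μ.real (⋃ n ∈ Finset.Ico N (N + M), A n)) atTop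
      (𝓝 (μ.real (⋃ M : ℕ, ⋃ n ∈ Finset.Ico N (N + M), A n))) :=
    (ENNReal.tendsto_toReal (measure_ne_top _ _)).comp (tendsto_measure_iUnion_atTop hmono)
  rw [hset]
  exact le_of_tendsto' hlim fun M => (hfin M).trans (sub_le_self _ (by positivity))

theorem IsRandomRel.eventually_not [IsFiniteMeasure P] (hx : IsRandomRel s P x)
    {E : Str D → Prop} (hE : CEIn s E)
    (hP : ∀ᶠ n : ℕ in atTop, P.real {y | E (word y 1 n)} ≤ 1 / (n * (n + 1))) :
    ∀ᶠ n in atTop, ¬E (word x 1 n) := by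
  obtain ⟨N, hN⟩ := eventually_atTop.1 hP
  have hlong : CEIn s fun p : ℕ × Str D => (N : ℚ) + 2 ^ p.1 < p.2.length :=
    ((ComputableRat.const N).add ((ComputableRat.const 2).pow Computable.fst)).lt
      (.natCast (Primrec.list_length.to_comp.comp Computable.snd))
  obtain ⟨k, hk⟩ := hx.exists_forall_not (hlong.and (hE.comp Computable.snd)) fun k => by
    have hsub : {y : Seq D | ∃ n, (N : ℚ) + 2 ^ k < (word y 1 n).length ∧ E (word y 1 n)} ⊆
        {y | ∃ n, N + 2 ^ k ≤ n ∧ y ∈ {y | E (word y 1 n)}} := by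
      rintro y ⟨n, hn, hy⟩
      rw [length_word] at hn
      exact ⟨n, by exact_mod_cast hn.le, hy⟩
    calc _ ≤ 1 / ((N + 2 ^ k : ℕ) : ℝ) :=
          (measureReal_mono hsub).trans (measureReal_exists_ge_le (by positivity)
            fun n hn => hN n ((Nat.le_add_right _ _).trans hn))
      _ ≤ 1 / 2 ^ k := one_div_le_one_div_of_le (by positivity) (by simp)
      _ = 2⁻¹ ^ k := by rw [inv_pow, one_div]
  filter_upwards [eventually_gt_atTop (N + 2 ^ k)] with n hn h
  exact hk n ⟨by rw [length_word]; exact_mod_cast hn, h⟩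

end Tests

section LawOfLargeNumbers

variable {D : ℕ} {s : Seq D} {P : Measure (Seq D)} {x : Seq D} {f : Str D → ℝ}

theorem realIn_prob_of_realIn_cylinder
    (hP : ComputableRealIn s fun p : Str D × Str D => P.real (cylinder p.1 p.2)) :
    ComputableRealIn s (prob P) := by
  have h := hP.comp ((Computable.const []).pair Computable.id)
  simp only [cylinder_nil] at h
  exact h

theorem ComputableMeasure.realIn_prob (hP : ComputableMeasure P) : ComputableRealIn s (prob P) :=
  realIn_prob_of_realIn_cylinder hP.2.realIn

theorem IsRepresentation.realIn_prob (hP : IsRepresentation s P) : ComputableRealIn s (prob P) := by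
  obtain ⟨ρ, hρ, rfl⟩ := hP
  exact realIn_prob_of_realIn_cylinder hρ.2.realIn

theorem IsRepresentation.isProbabilityMeasure (hP : IsRepresentation s P) :
    IsProbabilityMeasure P := by
  obtain ⟨ρ, hρ, rfl⟩ := hP
  exact hρ.1 s

theorem computable_dropLast : Computable (List.dropLast : Str D → Str D) := by
  refine (Primrec.list_take.comp (Primrec.nat_sub.comp Primrec.list_length (Primrec.const 1))
    Primrec.id).to_comp.of_eq fun w => ?_
  rw [List.dropLast_eq_take, id]

/-- The martingale difference `f (X_1^{n+1}) - E[f (X_1^{n+1}) | X_1^n]`, as a function of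
the string `X_1^{n+1}`. -/
noncomputable def innovation (P : Measure (Seq D)) (f : Str D → ℝ) (v : Str D) : ℝ :=
  f v - condMean P f v.dropLast

theorem innovation_word_succ (y : Seq D) (n : ℕ) :
    innovation P f (word y 1 (n + 1)) = f (word y 1 (n + 1)) - condMean P f (word y 1 n) := by
  rw [innovation, word_succ, List.dropLast_concat]

theorem innovation_const_mul (c : ℝ) (v : Str D) :
    innovation P (fun w => c * f w) v = c * innovation P f v := by
  simp only [innovation, condMean, mul_sub, Finset.mul_sum, mul_left_comm c]

theorem condMean_innovation [IsFiniteMeasure P] (w : Str D) :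
    condMean P (innovation P f) w = 0 := by
  have hsum : ∑ a, condProb P w a = prob P w / prob P w := by
    simp only [condProb, ← Finset.sum_div, sum_prob_concat]
  have hmean : condMean P f w * (prob P w / prob P w) = condMean P f w := by
    rcases eq_or_ne (prob P w) 0 with hw | hw
    · simp [condMean, condProb, hw]
    · rw [div_self hw, mul_one]
  rw [← hsum, Finset.mul_sum] at hmean
  nth_rw 1 [condMean]
  simp only [innovation, List.dropLast_concat, mul_sub, Finset.sum_sub_distrib]
  rw [sub_eq_zero, ← condMean, ← hmean]
  exact Finset.sum_congr rfl fun a _ => by rw [hmean, mul_comm]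

theorem abs_innovation_concat_le [IsFiniteMeasure P] {w : Str D} {b : ℝ}
    (hf : ∀ a, |f (w ++ [a])| ≤ b) (a : Fin D) : |innovation P f (w ++ [a])| ≤ 2 * b := by
  have hmean := abs_condMean_le P ((abs_nonneg _).trans (hf a)) hf
  rw [innovation, List.dropLast_concat, two_mul]
  exact (abs_sub _ _).trans (add_le_add (hf a) hmean)

-- Multiplying by the probability removes the denominators of the conditional probabilities.
theorem realIn_prob_mul_innovation [IsFiniteMeasure P] (hP : ComputableRealIn s (prob P))
    (hf : ComputableRealIn s f) :
    ComputableRealIn s fun v => prob P v.dropLast * innovation P f v := by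
  have hconcat (a : Fin D) : Computable fun v : Str D => v.dropLast ++ [a] :=
    Primrec.list_concat.to_comp.comp computable_dropLast (Computable.const a)
  simp only [innovation, mul_sub, prob_mul_condMean]
  simp only [sub_eq_add_neg]
  exact ((hP.comp computable_dropLast).mul hf).add (ComputableRealIn.finset_sum _ fun a _ =>
    (hP.comp (hconcat a)).mul (hf.comp (hconcat a))).neg

theorem ceIn_length_lt_sum_innovation [IsFiniteMeasure P] (hP : ComputableRealIn s (prob P))
    (hf : ComputableRealIn s f) :
    CEIn s fun w : Str D => (∀ i < w.length, 0 < prob P (w.take (i + 1)).dropLast) ∧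
      (w.length : ℝ) < ∑ i ∈ Finset.range w.length, innovation P f (w.take (i + 1)) := by
  have hbelow : CEIn s fun p : Str D × Code =>
      0 < prob P p.1.dropLast ∧ ((ratOf p.2 : ℚ) : ℝ) < innovation P f p.1 := by
    have hprob := hP.comp (computable_dropLast.comp (Computable.fst (β := Code)))
    have hcode := ComputableRealIn.of_rat (s := s) (.ratOf (Computable.snd (α := Str D)))
    refine ((hprob.rat_lt (.const 0)).and ((hprob.mul hcode).lt
      ((realIn_prob_mul_innovation hP hf).comp Computable.fst))).of_eq fun p => ?_
    rw [Rat.cast_zero]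
    exact and_congr_right fun hpos => mul_lt_mul_iff_right₀ hpos
  have htake : Computable fun p : (Str D × ℕ) × Code => (p.1.1.take (p.1.2 + 1), p.2) :=
    (Primrec.list_take.to_comp.comp (Computable.succ.comp (Computable.snd.comp Computable.fst))
      (Computable.fst.comp Computable.fst)).pair Computable.snd
  simpa using CEIn.lt_sum_range (U := fun p => 0 < prob P (p.1.take (p.2 + 1)).dropLast)
    (f := fun p => innovation P f (p.1.take (p.2 + 1))) (hbelow.comp htake)
    (.natCast Primrec.list_length.to_comp) Primrec.list_length.to_comp

theorem IsRandomRel.eventually_sum_innovation_le (hx : IsRandomRel s P x)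
    (hP : IsRepresentation s P) (hf : ComputableRealIn s f) {b : ℕ → ℝ}
    (hb : b =o[atTop] fun n : ℕ => Real.sqrt (n / Real.log n))
    (hfb : ∀ w a, |f (w ++ [a])| ≤ b w.length) :
    ∀ᶠ n : ℕ in atTop, ∑ i ∈ Finset.range n, innovation P f (word x 1 (i + 1)) ≤ n := by
  have := hP.isProbabilityMeasure
  have htake (y : Seq D) {i n : ℕ} (hi : i < n) : (word y 1 n).take (i + 1) = word y 1 (i + 1) :=
    take_word y 1 hi
  have hsum (y : Seq D) (n : ℕ) :
      ∑ i ∈ Finset.range n, innovation P f ((word y 1 n).take (i + 1)) =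
        ∑ i ∈ Finset.range n, innovation P f (word y 1 (i + 1)) :=
    Finset.sum_congr rfl fun i hi => by rw [htake y (Finset.mem_range.1 hi)]
  have hsmall := eventually_measureReal_lt_sum_range_le (P := P)
    (fun w => abs_innovation_concat_le (hfb w)) condMean_innovation
    (isLittleO_sum_range_sq (hb.const_mul_left 2))
  have hevent := hx.eventually_not (ceIn_length_lt_sum_innovation hP.realIn_prob hf) <| by
    filter_upwards [hsmall] with n hn
    refine (measureReal_mono fun y hy => ?_).trans hn
    simpa only [length_word, hsum] using! hy.2
  filter_upwards [hevent] with n hn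
  rw [length_word, hsum] at hn
  refine not_lt.1 fun hlt => hn ⟨fun i hi => ?_, hlt⟩
  rw [htake x hi, word_succ, List.dropLast_concat]
  exact hx.prob_pos i

theorem IsRandomRel.tendsto_sum_innovation_div (hx : IsRandomRel s P x)
    (hP : IsRepresentation s P) (hf : ComputableRealIn s f) {b : ℕ → ℝ}
    (hb : b =o[atTop] fun n : ℕ => Real.sqrt (n / Real.log n))
    (hfb : ∀ w a, |f (w ++ [a])| ≤ b w.length) :
    Tendsto (fun n : ℕ => (∑ i ∈ Finset.range n, innovation P f (word x 1 (i + 1))) / n) atTop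
      (𝓝 0) := by
  have hscaled (c : ℚ) : ∀ᶠ n : ℕ in atTop,
      c * ∑ i ∈ Finset.range n, innovation P f (word x 1 (i + 1)) ≤ n := by
    have hc := hx.eventually_sum_innovation_le hP ((ComputableRealIn.of_rat (.const c)).mul hf)
      (hb.const_mul_left |(c : ℝ)|) fun w a => by
        rw [abs_mul]
        exact mul_le_mul_of_nonneg_left (hfb w a) (abs_nonneg _)
    simpa only [innovation_const_mul, ← Finset.mul_sum] using hc
  refine Asymptotics.IsLittleO.tendsto_div_nhds_zero (Asymptotics.isLittleO_iff.2 fun ε hε => ?_)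
  obtain ⟨k, hk⟩ := exists_nat_gt ε⁻¹
  have hk0 : (0 : ℝ) < k := (inv_pos.2 hε).trans hk
  filter_upwards [hscaled k, hscaled (-k)] with n hle hge
  push_cast at hle hge
  rw [Real.norm_eq_abs, Real.norm_natCast]
  calc |∑ i ∈ Finset.range n, innovation P f (word x 1 (i + 1))| ≤ n / k :=
        abs_le'.2 ⟨by rw [le_div_iff₀ hk0]; linarith, by rw [le_div_iff₀ hk0]; linarith⟩
    _ ≤ ε * n := by
        rw [div_eq_inv_mul]
        gcongr
        exact inv_le_of_inv_le₀ hε hk.le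

end LawOfLargeNumbers

section CodeLength

variable {D : ℕ} {s : Seq D} {R : Measure (Seq D)}

/-- The ideal length `-log R(X_{n+1} | X_1^n)` of the code for the last letter of `X_1^{n+1}`, as a
function of the string `X_1^{n+1}`. -/
noncomputable def lastCodeLength (R : Measure (Seq D)) (v : Str D) : ℝ :=
  -Real.logb 2 (prob R v / prob R v.dropLast)

theorem lastCodeLength_concat (w : Str D) (a : Fin D) :
    lastCodeLength R (w ++ [a]) = -Real.logb 2 (condProb R w a) := by
  rw [lastCodeLength, List.dropLast_concat, condProb]

theorem condMean_lastCodeLength (P : Measure (Seq D)) (w : Str D) :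
    condMean P (lastCodeLength R) w =
      -∑ a, condProb P w a * Real.logb 2 (condProb R w a) := by
  simp only [condMean, lastCodeLength_concat, mul_neg, Finset.sum_neg_distrib]

theorem condProb_le_one [IsFiniteMeasure R] (w : Str D) (a : Fin D) : condProb R w a ≤ 1 :=
  div_le_one_of_le₀ (prob_append_le R w [a]) (prob_nonneg R w)

theorem lastCodeLength_concat_nonneg [IsFiniteMeasure R] (w : Str D) (a : Fin D) :
    0 ≤ lastCodeLength R (w ++ [a]) := by
  rw [lastCodeLength_concat, neg_nonneg]
  exact Real.logb_nonpos one_lt_two (condProb_nonneg R w a) (condProb_le_one w a)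

theorem prob_pos_of_forall_condProb_pos [IsFiniteMeasure R] {N : ℕ}
    (h : ∀ w : Str D, N ≤ w.length → ∀ a, 0 < condProb R w a) (a : Fin D) (w : Str D) :
    0 < prob R w := by
  have hpos := h (w ++ List.replicate N a) (by simp) a
  have hne : prob R (w ++ List.replicate N a) ≠ 0 := fun h0 => by simp [condProb, h0] at hpos
  exact ((prob_nonneg R _).lt_of_ne' hne).trans_le (prob_append_le R _ _)

theorem realIn_lastCodeLength (hR : ComputableRealIn s (prob R))
    (hpos : ∀ w, 0 < prob R w) : ComputableRealIn s (lastCodeLength R) := by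
  have hlog := hR.logb_two hpos
  have hdiff (v : Str D) : lastCodeLength R v =
      Real.logb 2 (prob R v.dropLast) + -Real.logb 2 (prob R v) := by
    rw [lastCodeLength, Real.logb_div (hpos _).ne' (hpos _).ne']
    ring
  rw [funext hdiff]
  exact (hlog.comp computable_dropLast).add hlog.neg

theorem sum_lastCodeLength_word [IsProbabilityMeasure R] (hpos : ∀ w, 0 < prob R w) (x : Seq D)
    (n : ℕ) : ∑ i ∈ Finset.range n, lastCodeLength R (word x 1 (i + 1)) =
      -Real.logb 2 (prob R (word x 1 n)) := by
  have hstep (i : ℕ) : lastCodeLength R (word x 1 (i + 1)) =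
      Real.logb 2 (prob R (word x 1 i)) - Real.logb 2 (prob R (word x 1 (i + 1))) := by
    rw [word_succ, lastCodeLength, List.dropLast_concat,
      Real.logb_div (hpos _).ne' (hpos _).ne', neg_sub]
  simp only [hstep]
  rw [Finset.sum_range_sub' (fun i => Real.logb 2 (prob R (word x 1 i)))]
  simp [word, prob]

theorem exists_isLittleO_bound_of_eventually_abs_le {f : Str D → ℝ} {g : ℕ → ℝ} {ε : ℕ → ℝ}
    (hε : Tendsto ε atTop (𝓝 0))
    (hf : ∀ᶠ n in atTop, ∀ w : Str D, w.length = n → ∀ a, |f (w ++ [a])| ≤ ε n * g n) :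
    ∃ b : ℕ → ℝ, b =o[atTop] g ∧ ∀ w a, |f (w ++ [a])| ≤ b w.length := by
  refine ⟨fun n => ⨆ p : (Fin n → Fin D) × Fin D, |f (List.ofFn p.1 ++ [p.2])|, ?_, fun w a => ?_⟩
  · have hsmall : (fun n => ε n * g n) =o[atTop] g := by
      simpa only [one_mul] using
        ((Asymptotics.isLittleO_one_iff ℝ).2 hε).mul_isBigO (Asymptotics.isBigO_refl g atTop)
    refine (Asymptotics.IsBigO.of_bound 1 ?_).trans_isLittleO hsmall
    filter_upwards [hf] with n hn
    rw [one_mul, Real.norm_of_nonneg (Real.iSup_nonneg fun p => abs_nonneg _)]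
    exact Real.iSup_le (fun p => (hn _ List.length_ofFn p.2).trans (Real.le_norm_self _))
      (norm_nonneg _)
  · simpa only [List.ofFn_get] using le_ciSup
      (f := fun p : (Fin w.length → Fin D) × Fin D => |f (List.ofFn p.1 ++ [p.2])|)
      (Set.finite_range _).bddAbove (w.get, a)

end CodeLength

end AlgRandom

theorem mainTheorem10_general {D : ℕ} {R : Measure (AlgRandom.Seq D)}
    (hR : AlgRandom.ComputableMeasure R) {ε : ℕ → ℝ} (hε : Tendsto ε atTop (𝓝 0))
    (hbound : ∀ n : ℕ, 2 ≤ n → ∀ w : AlgRandom.Str D, w.length = n → ∀ a : Fin D,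
      0 < AlgRandom.condProb R w a ∧
      -Real.logb 2 (AlgRandom.condProb R w a) ≤ ε n * Real.sqrt ((n : ℝ) / Real.log (n : ℝ)))
    {P : Measure (AlgRandom.Seq D)} {x : AlgRandom.Seq D} (hx : AlgRandom.IsMartinLofRandom P x) :
    (∀ n : ℕ, 0 < AlgRandom.prob P (AlgRandom.word x 1 n)) ∧
    Tendsto
      (fun n : ℕ => (∑ i ∈ Finset.range n,
        -∑ a : Fin D, AlgRandom.condProb P (AlgRandom.word x 1 i) a *
          Real.logb 2 (AlgRandom.condProb R (AlgRandom.word x 1 i) a)) / (n : ℝ) -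
        -Real.logb 2 (AlgRandom.prob R (AlgRandom.word x 1 n)) / (n : ℝ))
      atTop (𝓝 0) := by
  obtain ⟨s, hs, hrandom⟩ := hx
  have := hR.1
  have := hs.isProbabilityMeasure
  have hpos := AlgRandom.prob_pos_of_forall_condProb_pos
    (fun w hw a => (hbound _ hw w rfl a).1) (x 0)
  obtain ⟨b, hb, hlast⟩ := AlgRandom.exists_isLittleO_bound_of_eventually_abs_le
    (f := AlgRandom.lastCodeLength R) hε <| by
      filter_upwards [eventually_ge_atTop 2] with n hn w hw a
      rw [abs_of_nonneg (AlgRandom.lastCodeLength_concat_nonneg w a),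
        AlgRandom.lastCodeLength_concat]
      exact (hbound n hn w hw a).2
  have hlaw := (hrandom.tendsto_sum_innovation_div hs
    (AlgRandom.realIn_lastCodeLength hR.realIn_prob hpos) hb hlast).neg
  simp only [AlgRandom.innovation_word_succ, Finset.sum_sub_distrib,
    AlgRandom.sum_lastCodeLength_word hpos, AlgRandom.condMean_lastCodeLength] at hlaw
  refine ⟨hrandom.prob_pos, ?_⟩
  simpa only [neg_zero, ← neg_div, neg_sub, sub_div] using hlaw

theorem mainTheorem10 (D : ℕ) (hD : 2 ≤ D)
    (R : Measure (AlgRandom.Seq D)) (hR : AlgRandom.IsOneUniversal R)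
    (ε : ℕ → ℝ) (hε : Tendsto ε atTop (𝓝 0))
    (hbound : ∀ n : ℕ, 2 ≤ n → ∀ w : AlgRandom.Str D, w.length = n → ∀ a : Fin D,
      0 < AlgRandom.condProb R w a ∧
      -Real.logb 2 (AlgRandom.condProb R w a) ≤ ε n * Real.sqrt ((n : ℝ) / Real.log (n : ℝ)))
    (P : Measure (AlgRandom.Seq D)) (hP : AlgRandom.IsStationaryErgodic P)
    (x : AlgRandom.Seq D) (hx : AlgRandom.IsMartinLofRandom P x) :
    (∀ n : ℕ, 0 < AlgRandom.prob P (AlgRandom.word x 1 n)) ∧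
    Tendsto
      (fun n : ℕ => (∑ i ∈ Finset.range n,
        -∑ a : Fin D, AlgRandom.condProb P (AlgRandom.word x 1 i) a *
          Real.logb 2 (AlgRandom.condProb R (AlgRandom.word x 1 i) a)) / (n : ℝ))
      atTop (𝓝 (AlgRandom.entropyRate P)) := by
  obtain ⟨hpos, hlim⟩ := mainTheorem10_general hR.1 hε hbound hx
  exact ⟨hpos, by simpa using hlim.add (hR.2 P hP x hx).2⟩
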